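/- Let $n, m$ be natural numbers and $S=\mathbb C[x_0,\dots,x_n]$. A one-form $\alpha=\sum_j a_j\,dx_j$ on $\mathbb C^{n+1}$ with $a_j\in S$ is said to be of degree $e$ if all $a_j$ are homogeneous of degree $e-1$ (so $\alpha = 0$ if $e=0$); it is a projective one-form of degree $e$ (an element of $H^0(\mathbb P^n,\Omega^1_{\mathbb P^n}(e))$) if moreover its contraction $\sum_j a_jx_j$ with the radial vector field is zero. Let $F_1,\dots,F_m\in S$ be homogeneous of degrees $d_1,\dots,d_m$, put $d=\sum_i d_i$ and $\hat F_i=\prod_{j\ne i}F_j$. Assume that the hypersurfaces $X_i=\{F_i=0\}\subset\mathbb P^n$ are smooth and irreducible and that $\bigcup_i X_i$ is a normal crossings divisor, that is: each $F_i$ is an irreducible polynomial, and at each point $x\in\mathbb C^{n+1}\setminus\{0\}$ the differentials $dF_i(x)$ of those $F_i$ with $F_i(x)=0$ are linearly independent. Let $X^{(2)}=\bigcup_{i<j}X_i\cap X_j\subset\mathbb P^n$ and let $\tilde X^{(2)}=\bigcup_{i<j}\{x\in\mathbb C^{n+1} : F_i(x)=F_j(x)=0\}$ be the cone over it. Let $\alpha$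 be a one-form of degree $d$ on $\mathbb C^{n+1}$. Then: a) $\alpha$ vanishes on $\tilde X^{(2)}$ if and only if it may be written as $\alpha=\sum_{i=1}^m\hat F_i\,\alpha_i$ for some one-forms $\alpha_i$ of degree $d_i$ on $\mathbb C^{n+1}$. b) $\alpha$ is projective and vanishes on $X^{(2)}$ if and only if it may be written as $$\alpha=\sum_{i=1}^m\lambda'_i\,\hat F_i\,dF_i+\sum_{i=1}^m\hat F_i\,\gamma_i$$ with $\lambda'_i\in\mathbb C$, $\sum_{i=1}^m d_i\lambda'_i=0$, and $\gamma_i$ projective one-forms of degrees $d_i$. -/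

import Mathlib

open MvPolynomial KaehlerDifferential
open scoped LinearAlgebra.Projectivization

noncomputable section

namespace LogForms

/-- The graded ring of complex polynomials in the variables `x₀, …, xₙ`. -/
abbrev PolyRing (n : ℕ) : Type := MvPolynomial (Fin (n + 1)) ℂ

/-- Algebraic one-forms on the affine space `ℂⁿ⁺¹`: the Kähler differentials of `PolyRing n`. -/
abbrev OneForm (n : ℕ) : Type := Ω[PolyRing n⁄ℂ]

/-- The exterior derivative `dG` of a polynomial `G`. -/
abbrev extD {n : ℕ} (G : PolyRing n) : OneForm n := D ℂ (PolyRing n) G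

/-- The coefficient `a_j` of `dx_j` in `α = ∑ⱼ a_j dx_j`. -/
def formCoeff {n : ℕ} (α : OneForm n) (j : Fin (n + 1)) : PolyRing n :=
  (mvPolynomialBasis ℂ (Fin (n + 1))).repr α j

/-- `α` lies in the homogeneous piece of degree `d` (each `dx_j` has degree one): its
coefficients are homogeneous of degree `d - 1`, and `α = 0` if `d = 0`. -/
def IsFormOfDegree {n : ℕ} (d : ℕ) (α : OneForm n) : Prop :=
  ∀ j, (formCoeff α j).IsHomogeneous (d - 1) ∧ (d = 0 → formCoeff α j = 0)

/-- The contraction `⟨R, α⟩ = ∑ⱼ a_j x_j` with the radial vector field `R = ∑ⱼ x_j ∂/∂x_j`. -/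
def radialContraction {n : ℕ} (α : OneForm n) : PolyRing n :=
  ∑ j, formCoeff α j * X j

/-- `α` is a projective one-form of degree `d`: homogeneous of degree `d` and killed by
contraction with the radial vector field. -/
def IsProjectiveForm {n : ℕ} (d : ℕ) (α : OneForm n) : Prop :=
  IsFormOfDegree d α ∧ radialContraction α = 0

/-- The value `α(x)`, as the vector of the values of its coefficients. -/
def formValue {n : ℕ} (α : OneForm n) (x : Fin (n + 1) → ℂ) : Fin (n + 1) → ℂ :=
  fun j => eval x (formCoeff α j)

/-- `F̂_i = ∏_{j ≠ i} F_j`. -/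
def hatProd {n m : ℕ} (F : Fin m → PolyRing n) (i : Fin m) : PolyRing n :=
  ∏ j ∈ Finset.univ.erase i, F j

/-- The affine cone over the stratum of order `r`: the union over all `A` with `|A| = r` of the
common zero sets in `ℂⁿ⁺¹` of the `F_i`, `i ∈ A`. -/
def coneStratum {n m : ℕ} (F : Fin m → PolyRing n) (r : ℕ) : Set (Fin (n + 1) → ℂ) :=
  {x | ∃ A : Finset (Fin m), A.card = r ∧ ∀ i ∈ A, eval x (F i) = 0}

/-- The stratum of order `r` in the projective space `ℙⁿ`: the union over all `A` with `|A| = r`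
of the intersections of the hypersurfaces `F_i = 0`, `i ∈ A`. -/
def projStratum {n m : ℕ} (F : Fin m → PolyRing n) (r : ℕ) : Set (ℙ ℂ (Fin (n + 1) → ℂ)) :=
  {p | ∃ (x : Fin (n + 1) → ℂ) (hx : x ≠ 0),
    x ∈ coneStratum F r ∧ Projectivization.mk ℂ x hx = p}

/-- `α` vanishes on a subset of the affine space. -/
def VanishesOnAffine {n : ℕ} (α : OneForm n) (Y : Set (Fin (n + 1) → ℂ)) : Prop :=
  ∀ x ∈ Y, formValue α x = 0

/-- `α` vanishes on a subset of the projective space: its value at any homogeneous coordinates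
of a point of the set is zero. -/
def VanishesOnProj {n : ℕ} (α : OneForm n) (Y : Set (ℙ ℂ (Fin (n + 1) → ℂ))) : Prop :=
  ∀ (x : Fin (n + 1) → ℂ) (hx : x ≠ 0), Projectivization.mk ℂ x hx ∈ Y → formValue α x = 0

/-- The hypersurfaces `F_i = 0` in `ℙⁿ` are smooth and irreducible, and their union is a normal
crossings divisor: the `F_i` are irreducible polynomials, and at every point of `ℙⁿ` the
differentials of those `F_i` that vanish at the point are linearly independent. -/
structure NormalCrossings {n m : ℕ} (F : Fin m → PolyRing n) : Prop where
  irreducible : ∀ i, Irreducible (F i)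
  transversal : ∀ x : Fin (n + 1) → ℂ, x ≠ 0 →
    LinearIndependent ℂ (fun i : {i : Fin m // eval x (F i) = 0} => formValue (extD (F i.1)) x)

end LogForms

end

/-! ### Regular local rings: quotients by parameters, and integrality. -/

section RegularLocal

open IsLocalRing

/-! The first equivalence is proved coefficient by coefficient: a homogeneous `a` of degree `d - 1`
vanishing on the cone must lie in the ideal generated by the `F̂_i`.

Suppose `n ≥ 2`. Then each `(F_i, F_j)` is radical. Away from the origin, transversality makes `F_i,
F_j` independent in the cotangent space of a regular local ring, so they generate a prime ideal
locally (`IsRegularLocalRing.isPrime_span_pair`). At the origin, having at least three variables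
gives `S/(F_i, F_j)` positive depth, so no embedded component sits there
(`MvPolynomial.mem_span_pair_of_forall_exists`). The same local-to-global argument makes a third
`F_k` a nonzerodivisor modulo `(F_i, F_j)`, and pure algebra then shows that `⋂ (F_i, F_j)` is
generated by the `F̂_i` (`exists_eq_sum_prod_erase_mul`).

For `n = 1` the `F_i` are pairwise non-proportional linear forms, and the degree `m - 1` turns the
claim into Lagrange interpolation. For `n = 0` homogeneous polynomials are monomials.

For the second equivalence, contracting `∑ F̂_i α_i` with the radial field gives `∑ F̂_i e_i = 0`.
For `n ≥ 1`, `F_i` is prime and does not divide `F̂_i`, so it divides `e_i`; by degree `e_i = c_i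
F_i`, and `∑ c_i = 0`. By Euler's identity, subtracting `(c_i / d_i) dF_i` from `α_i` makes it
projective. -/

theorem exists_finite_span_insert_eq_top {K V : Type*} [Field K] [AddCommGroup V] [Module K V]
    [FiniteDimensional K V] {v : V} (hv : v ≠ 0) :
    ∃ s : Set V, s.Finite ∧ s.ncard + 1 = Module.finrank K V ∧
      Submodule.span K (insert v s) = ⊤ := by
  have hli : LinearIndepOn K id ({v} : Set V) := by
    simpa using hv
  have hsub := hli.subset_extend (Set.subset_univ _)
  have hE : LinearIndepOn K id (hli.extend (Set.subset_univ _)) :=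
    hli.linearIndepOn_extend (Set.subset_univ _)
  have hspan := hli.span_extend_eq_span (Set.subset_univ _)
  set E := hli.extend (Set.subset_univ _) with hEdef
  have hvE : v ∈ E := hsub rfl
  let b := Module.Basis.extend hli
  have hfin : E.Finite := hE.setFinite
  refine ⟨E \ {v}, hfin.sdiff, ?_, ?_⟩
  · rw [Set.ncard_sdiff_singleton_add_one hvE hfin, Module.finrank_eq_nat_card_basis b]
    rfl
  · rw [Set.insert_sdiff_singleton, Set.insert_eq_of_mem hvE]
    simpa using hspan

variable {R : Type*} [CommRing R]

/-- Nakayama: extend the nonzero class of `y` to a basis of the cotangent space and lift it. -/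
theorem IsLocalRing.exists_finite_span_insert_eq_maximalIdeal [IsLocalRing R] [IsNoetherianRing R]
    {y : R} (hy : y ∈ maximalIdeal R) (hy2 : y ∉ maximalIdeal R ^ 2) :
    ∃ s : Set R, s.Finite ∧ s.ncard + 1 ≤ (maximalIdeal R).spanFinrank ∧
      Ideal.span (insert y s) = maximalIdeal R := by
  have hv : (maximalIdeal R).toCotangent ⟨y, hy⟩ ≠ 0 := by
    rwa [Ne, Ideal.toCotangent_eq_zero]
  obtain ⟨s, hs, hcard, hspan⟩ :=
    exists_finite_span_insert_eq_top (K := ResidueField R) (V := CotangentSpace R) hv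
  obtain ⟨σ, hσ⟩ := (maximalIdeal R).toCotangent_surjective.hasRightInverse
  refine ⟨(fun v => (σ v : R)) '' s, hs.image _, ?_, ?_⟩
  · rw [spanFinrank_maximalIdeal_eq_finrank_cotangentSpace, ← hcard]
    exact Nat.succ_le_succ (Set.ncard_image_le hs)
  · have h1 : (maximalIdeal R).toCotangent '' (insert ⟨y, hy⟩ (σ '' s)) =
        insert ((maximalIdeal R).toCotangent ⟨y, hy⟩) s := by
      rw [Set.image_insert_eq, ← Set.image_comp]
      congr 1
      have : (⇑(maximalIdeal R).toCotangent ∘ σ) = id := funext hσ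
      rw [this, Set.image_id]
    rw [← h1, CotangentSpace.span_image_eq_top_iff] at hspan
    have h2 := congrArg (Submodule.map (maximalIdeal R).subtype) hspan
    rw [Submodule.map_span, Submodule.map_top, Submodule.range_subtype, Set.image_insert_eq,
      ← Set.image_comp] at h2
    exact h2

theorem IsLocalRing.quotient_span_singleton [IsLocalRing R] {y : R} (hy : y ∈ maximalIdeal R) :
    IsLocalRing (R ⧸ Ideal.span {y}) := by
  have hne : Ideal.span {y} ≠ ⊤ := by
    rwa [Ne, Ideal.span_singleton_eq_top]
  have : Nontrivial (R ⧸ Ideal.span {y}) := Ideal.Quotient.nontrivial_iff.mpr hne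
  exact IsLocalRing.of_surjective' (Ideal.Quotient.mk _) Ideal.Quotient.mk_surjective

/-- Killing a minimal generator lowers the embedding dimension by at least one, while the Krull
dimension drops by at most one, so equality persists. -/
theorem IsRegularLocalRing.quotient_span_singleton [IsRegularLocalRing R] {y : R}
    [IsLocalRing (R ⧸ Ideal.span {y})] (hy : y ∈ maximalIdeal R) (hy2 : y ∉ maximalIdeal R ^ 2) :
    IsRegularLocalRing (R ⧸ Ideal.span {y}) ∧
      (maximalIdeal (R ⧸ Ideal.span {y})).spanFinrank + 1 ≤ (maximalIdeal R).spanFinrank := by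
  obtain ⟨s, hs, hcard, hspan⟩ := exists_finite_span_insert_eq_maximalIdeal hy hy2
  have hmap : maximalIdeal (R ⧸ Ideal.span {y}) =
      Ideal.span (Ideal.Quotient.mk (Ideal.span {y}) '' s) := by
    have h1 := IsLocalRing.map_maximalIdeal_of_surjective (Ideal.Quotient.mk (Ideal.span {y}))
      Ideal.Quotient.mk_surjective
    rw [← h1, ← hspan, Ideal.map_span, Set.image_insert_eq]
    have : Ideal.Quotient.mk (Ideal.span {y}) y = 0 :=
      Ideal.Quotient.eq_zero_iff_mem.mpr (Ideal.mem_span_singleton_self y)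
    rw [this, Ideal.span_insert_zero]
  have hle : (maximalIdeal (R ⧸ Ideal.span {y})).spanFinrank + 1 ≤
      (maximalIdeal R).spanFinrank := by
    refine le_trans (Nat.succ_le_succ ?_) hcard
    rw [hmap]
    exact (Submodule.spanFinrank_span_le_ncard_of_finite (hs.image _)).trans
      (Set.ncard_image_le hs)
  have hdim : ringKrullDim R ≤ ringKrullDim (R ⧸ Ideal.span {y}) + 1 := by
    have := ringKrullDim_le_ringKrullDim_quotient_add_card (R := R) {y} (by
      rw [IsLocalRing.ringJacobson_eq_maximalIdeal]
      simpa using hy)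
    rwa [Finset.coe_singleton, Finset.card_singleton, Nat.cast_one] at this
  have hle' : (((maximalIdeal (R ⧸ Ideal.span {y})).spanFinrank : ℕ) : WithBot ℕ∞) + 1 ≤
      ringKrullDim R := by
    rw [← IsRegularLocalRing.spanFinrank_maximalIdeal (R := R)]
    exact_mod_cast hle
  exact ⟨IsRegularLocalRing.of_spanFinrank_maximalIdeal_le _
    (ENat.WithBot.add_le_add_one_right_iff.mp (hle'.trans hdim)), hle⟩

/-- Choose `y` in the maximal ideal, outside its square and all minimal primes. By induction `(y)`
is prime, so it contains a minimal prime `q`. Since `y ∉ q`, every element of `q` is `y` times an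
element of `q`, and Nakayama gives `q = 0`. -/
theorem IsRegularLocalRing.isDomain_of_spanFinrank_le (N : ℕ) :
    ∀ (R : Type*) [CommRing R] [IsRegularLocalRing R], (maximalIdeal R).spanFinrank ≤ N →
      IsDomain R := by
  induction N with
  | zero =>
    intro R _ _ h
    have hbot : maximalIdeal R = ⊥ :=
      (Submodule.spanFinrank_eq_zero_iff_eq_bot (IsNoetherian.noetherian _)).mp (Nat.le_zero.mp h)
    exact (IsLocalRing.isField_iff_maximalIdeal_eq.mpr hbot).isDomain
  | succ N ih =>
    intro R _ _ h
    by_cases hbot : maximalIdeal R = ⊥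
    · exact (IsLocalRing.isField_iff_maximalIdeal_eq.mpr hbot).isDomain
    have hav : ¬ ((maximalIdeal R : Set R) ⊆
        ⋃ i ∈ insert (maximalIdeal R ^ 2) (minimalPrimes R), ((id i : Ideal R) : Set R)) := by
      -- Prime avoidance allows two non-prime members; the square of the maximal ideal fills both
      -- slots.
      rw [Ideal.subset_union_prime_finite
        ((Ideal.finite_minimalPrimes_of_isNoetherianRing R ⊥).insert _) (maximalIdeal R ^ 2)
        (maximalIdeal R ^ 2)]
      · rintro ⟨i, hi | hi, hle⟩
        · subst hi
          refine hbot (Submodule.eq_bot_of_le_smul_of_le_jacobson_bot (maximalIdeal R) _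
            (IsNoetherian.noetherian _) ?_ (maximalIdeal_le_jacobson _))
          rwa [smul_eq_mul, ← pow_two]
        · have hpr : i.IsPrime := Ideal.IsMinimalPrime.isPrime hi
          have him : i = maximalIdeal R := le_antisymm (le_maximalIdeal hpr.ne_top) hle
          have hht : (maximalIdeal R).height = 0 := by
            rw [← him]
            exact Ideal.height_eq_zero_iff.mpr hi
          have hsp := IsRegularLocalRing.spanFinrank_maximalIdeal (R := R)
          rw [← maximalIdeal_height_eq_ringKrullDim, hht] at hsp
          exact hbot ((Submodule.spanFinrank_eq_zero_iff_eq_bot (IsNoetherian.noetherian _)).mp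
            (by exact_mod_cast hsp))
      · rintro i (hi | hi) h1 -
        · exact absurd hi h1
        · exact Ideal.IsMinimalPrime.isPrime hi
    obtain ⟨y, hy, hyU⟩ := Set.not_subset.mp hav
    simp only [Set.mem_iUnion, not_exists, Set.mem_insert_iff] at hyU
    have hy2 : y ∉ maximalIdeal R ^ 2 := hyU _ (Or.inl rfl)
    have := IsLocalRing.quotient_span_singleton hy
    obtain ⟨hreg, hrank⟩ := IsRegularLocalRing.quotient_span_singleton hy hy2
    have hdom : IsDomain (R ⧸ Ideal.span {y}) := ih _ (by omega)
    have hprime : (Ideal.span {y}).IsPrime := (Ideal.Quotient.isDomain_iff_prime _).mp hdom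
    obtain ⟨q, hq, hqy⟩ := Ideal.exists_minimalPrimes_le (bot_le : ⊥ ≤ Ideal.span {y})
    have hqp : q.IsPrime := Ideal.IsMinimalPrime.isPrime hq
    have hyq : y ∉ q := hyU q (Or.inr hq)
    have hq0 : q = ⊥ := by
      refine Submodule.eq_bot_of_le_smul_of_le_jacobson_bot (maximalIdeal R) _
        (IsNoetherian.noetherian _) (fun z hz => ?_) (maximalIdeal_le_jacobson _)
      obtain ⟨w, rfl⟩ := Ideal.mem_span_singleton'.mp (hqy hz)
      rw [mul_comm]
      exact Ideal.mul_mem_mul hy ((hqp.mem_or_mem hz).resolve_right hyq)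
    subst hq0
    exact IsDomain.of_bot_isPrime R

/-- A regular local ring is an integral domain. -/
theorem IsRegularLocalRing.isDomain (R : Type*) [CommRing R] [IsRegularLocalRing R] :
    IsDomain R :=
  isDomain_of_spanFinrank_le _ R le_rfl

/-- Two elements of the maximal ideal of a regular local ring that are linearly independent in the
cotangent space generate a prime ideal. -/
theorem IsRegularLocalRing.isPrime_span_pair [IsRegularLocalRing R] {f g : R}
    (hf : f ∈ maximalIdeal R) (hf2 : f ∉ maximalIdeal R ^ 2) (hg : g ∈ maximalIdeal R)
    (hg2 : g ∉ maximalIdeal R ^ 2 ⊔ Ideal.span {f}) : (Ideal.span {f, g}).IsPrime := by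
  have := IsLocalRing.quotient_span_singleton hf
  have hreg := (IsRegularLocalRing.quotient_span_singleton hf hf2).1
  have hm := IsLocalRing.map_maximalIdeal_of_surjective (Ideal.Quotient.mk (Ideal.span {f}))
    Ideal.Quotient.mk_surjective
  have hg1 : Ideal.Quotient.mk (Ideal.span {f}) g ∈ maximalIdeal (R ⧸ Ideal.span {f}) :=
    hm ▸ Ideal.mem_map_of_mem _ hg
  have hg3 : Ideal.Quotient.mk (Ideal.span {f}) g ∉ maximalIdeal (R ⧸ Ideal.span {f}) ^ 2 := by
    rwa [← hm, ← Ideal.map_pow, Ideal.mem_quotient_iff_mem_sup]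
  have := IsLocalRing.quotient_span_singleton hg1
  have hreg2 := (IsRegularLocalRing.quotient_span_singleton hg1 hg3).1
  have hprime := (Ideal.Quotient.isDomain_iff_prime _).mp (IsRegularLocalRing.isDomain
    ((R ⧸ Ideal.span {f}) ⧸ Ideal.span {Ideal.Quotient.mk (Ideal.span {f}) g}))
  have heq : Ideal.span {f, g} =
      (Ideal.span {Ideal.Quotient.mk (Ideal.span {f}) g}).comap (Ideal.Quotient.mk _) := by
    ext u
    rw [Ideal.mem_comap, ← Set.image_singleton, ← Ideal.map_span, Ideal.mem_quotient_iff_mem_sup,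
      sup_comm, ← Ideal.span_union, Set.singleton_union]
  rw [heq]
  exact Ideal.IsPrime.comap _

end RegularLocal

/-! ### From independent differentials to local primality. -/

section LocalPrimality

open MvPolynomial IsLocalRing

variable {σ K : Type*} [Field K]

theorem MvPolynomial.eval_pderiv_eq_zero_of_mem_sq {x : σ → K} {u : MvPolynomial σ K}
    (hu : u ∈ RingHom.ker (eval x) ^ 2) (j : σ) : eval x (pderiv j u) = 0 := by
  rw [pow_two] at hu
  refine Submodule.mul_induction_on hu (fun a ha b hb => ?_) (fun a b ha hb => ?_)
  · rw [RingHom.mem_ker] at ha hb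
    simp [Derivation.leibniz, ha, hb]
  · simp [ha, hb]

/-- `Q` is the contraction of `(f, g)` from the local ring at `x`. Differentiating at `x` kills the
square of the maximal ideal, so independent gradients give independent cotangent classes. -/
theorem MvPolynomial.exists_isPrime_of_linearIndependent [Finite σ] {x : σ → K}
    {f g : MvPolynomial σ K} (hf : eval x f = 0) (hg : eval x g = 0)
    (hfg : LinearIndependent K
      ![fun j => eval x (pderiv j f), fun j => eval x (pderiv j g)]) :
    ∃ Q : Ideal (MvPolynomial σ K), Q.IsPrime ∧ ∀ u, u ∈ Q ↔
      ∃ s, eval x s ≠ 0 ∧ s * u ∈ Ideal.span {f, g} := by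
  rw [LinearIndependent.pair_iff] at hfg
  set P : Ideal (MvPolynomial σ K) := RingHom.ker (eval x) with hPdef
  have hP : P.IsPrime := RingHom.ker_isPrime _
  set R := Localization.AtPrime P
  have : IsRegularLocalRing R :=
    IsRegularRing.isRegularLocalRing_localization P
  have hm : maximalIdeal R = P.map (algebraMap _ R) :=
    (Localization.AtPrime.map_eq_maximalIdeal).symm
  have hmem : ∀ (I : Ideal (MvPolynomial σ K)) (u : MvPolynomial σ K),
      algebraMap _ R u ∈ I.map (algebraMap _ R) ↔ ∃ s, eval x s ≠ 0 ∧ s * u ∈ I := by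
    intro I u
    rw [IsLocalization.algebraMap_mem_map_algebraMap_iff P.primeCompl]
    rfl
  have hfm : algebraMap _ R f ∈ maximalIdeal R := hm ▸ Ideal.mem_map_of_mem _ hf
  have hgm : algebraMap _ R g ∈ maximalIdeal R := hm ▸ Ideal.mem_map_of_mem _ hg
  have hf2 : algebraMap _ R f ∉ maximalIdeal R ^ 2 := by
    rw [hm, ← Ideal.map_pow, hmem]
    rintro ⟨s, hs, hsf⟩
    refine hs (hfg (eval x s) 0 ?_).1
    ext j
    simpa [Derivation.leibniz, hf] using eval_pderiv_eq_zero_of_mem_sq hsf j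
  have hg2 : algebraMap _ R g ∉ maximalIdeal R ^ 2 ⊔ Ideal.span {algebraMap _ R f} := by
    rw [hm, ← Ideal.map_pow, ← Set.image_singleton, ← Ideal.map_span, ← Ideal.map_sup, hmem]
    rintro ⟨s, hs, hsg⟩
    obtain ⟨t, ht, w, hw, htw⟩ := Submodule.mem_sup.mp hsg
    obtain ⟨c, rfl⟩ := Ideal.mem_span_singleton'.mp hw
    refine hs (hfg (-eval x c) (eval x s) ?_).2
    ext j
    have h1 := congrArg (fun u => eval x (pderiv j u)) htw
    have h2 := eval_pderiv_eq_zero_of_mem_sq ht j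
    simp [Derivation.leibniz, hf, hg, h2] at h1
    simp [← h1]
  have hprime := IsRegularLocalRing.isPrime_span_pair hfm hf2 hgm hg2
  refine ⟨(Ideal.span {algebraMap _ R f, algebraMap _ R g}).comap (algebraMap _ R),
    Ideal.IsPrime.comap _, fun u => ?_⟩
  rw [Ideal.mem_comap, ← Set.image_pair, ← Ideal.map_span, hmem]

end LocalPrimality

/-! ### Absence of an embedded component at the origin; radicality of `(f, g)`. -/

section Saturation

open MvPolynomial

variable {σ K : Type*} [Field K]

theorem MvPolynomial.sub_aeval_mem {R : Type*} [CommRing R] {I : Ideal (MvPolynomial σ R)}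
    {v : σ → MvPolynomial σ R} (hv : ∀ i, X i - v i ∈ I) (a : MvPolynomial σ R) :
    a - aeval v a ∈ I := by
  have h : (Ideal.Quotient.mkₐ R I).comp (aeval v) = Ideal.Quotient.mkₐ R I := by
    refine MvPolynomial.algHom_ext fun i => ?_
    rw [AlgHom.comp_apply, aeval_X]
    exact ((Ideal.Quotient.mk_eq_mk_iff_sub_mem _ _).mpr (hv i)).symm
  exact (Ideal.Quotient.mk_eq_mk_iff_sub_mem _ _).mp (DFunLike.congr_fun h a).symm

/-- The linear form `X i - (p i / p k) X k`, which vanishes at the point `p`. -/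
noncomputable def MvPolynomial.pointForm (p : σ → K) (k i : σ) : MvPolynomial σ K :=
  X i - C (p i / p k) * X k

theorem Irreducible.totalDegree_ne_zero {f : MvPolynomial σ K} (hf : Irreducible f) :
    f.totalDegree ≠ 0 := by
  intro h0
  have hC := totalDegree_eq_zero_iff_eq_C.mp h0
  refine hf.not_isUnit (hC ▸ IsUnit.map C (isUnit_iff_ne_zero.mpr fun h1 => hf.ne_zero ?_))
  rw [hC, h1, map_zero]

theorem Irreducible.exists_eq_mul_C_of_dvd {f l : MvPolynomial σ K} (hf : Irreducible f)
    (hl : l ≠ 0) (hdeg : l.totalDegree ≤ 1) (h : f ∣ l) : ∃ c, l = f * C c := by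
  obtain ⟨q, rfl⟩ := h
  rw [totalDegree_mul_of_isDomain hf.ne_zero (right_ne_zero_of_mul hl)] at hdeg
  have := hf.totalDegree_ne_zero
  exact ⟨_, congrArg _ (totalDegree_eq_zero_iff_eq_C.mp (show q.totalDegree = 0 by omega))⟩

variable {p : σ → K} {i j k : σ}

theorem MvPolynomial.eval_pointForm (hk : p k ≠ 0) (i : σ) : eval p (pointForm p k i) = 0 := by
  simp [pointForm, hk]

theorem MvPolynomial.eval_zero_pointForm (i : σ) : eval 0 (pointForm p k i) = 0 := by
  simp [pointForm]

theorem MvPolynomial.totalDegree_pointForm_le (i : σ) :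
    (pointForm p k i).totalDegree ≤ 1 := by
  refine (totalDegree_sub _ _).trans (max_le (totalDegree_X i).le ?_)
  refine (totalDegree_mul _ _).trans ?_
  simp

theorem MvPolynomial.pointForm_ne_zero (hik : i ≠ k) : pointForm p k i ≠ 0 := by
  classical
  intro h
  have := congrArg (eval (Pi.single i (1 : K))) h
  simp [pointForm, hik.symm] at this

/-- Substituting for `X i` kills the `i`-th form and fixes the `j`-th, so it kills `w`. -/
theorem MvPolynomial.pointForm_dvd_of_mul_eq_mul (hik : i ≠ k) (hjk : j ≠ k) (hij : i ≠ j)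
    {u w : MvPolynomial σ K} (h : pointForm p k j * w = pointForm p k i * u) :
    pointForm p k i ∣ w := by
  classical
  set v : σ → MvPolynomial σ K := Function.update X i (C (p i / p k) * X k) with hv
  have hi : aeval v (pointForm p k i) = 0 := by
    simp [pointForm, hv, Function.update_of_ne hik.symm, algebraMap_eq]
  have hj : aeval v (pointForm p k j) = pointForm p k j := by
    simp [pointForm, hv, Function.update_of_ne hik.symm, Function.update_of_ne hij.symm,
      algebraMap_eq]
  have hw := congrArg (aeval v) h
  rw [map_mul, map_mul, hi, hj, zero_mul, mul_eq_zero] at hw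
  have hw0 := hw.resolve_left (pointForm_ne_zero hjk)
  have hmem := sub_aeval_mem (I := Ideal.span {pointForm p k i}) (v := v) (fun l => ?_) w
  · rwa [hw0, sub_zero, Ideal.mem_span_singleton] at hmem
  · by_cases hl : l = i
    · subst hl
      have : X l - v l = pointForm p k l := by simp [hv, pointForm]
      rw [this]
      exact Ideal.mem_span_singleton_self _
    · simp [hv, Function.update_of_ne hl]

theorem MvPolynomial.mem_span_pointForm_of_mul_mem (hk : p k ≠ 0) (hik : i ≠ k) (hjk : j ≠ k)
    (hij : i ≠ j) {f c : MvPolynomial σ K} (hf : eval p f ≠ 0)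
    (h : c * f ∈ Ideal.span {pointForm p k i, pointForm p k j}) :
    c ∈ Ideal.span {pointForm p k i, pointForm p k j} := by
  classical
  set v : σ → MvPolynomial σ K :=
    Function.update (Function.update X i (C (p i / p k) * X k)) j (C (p j / p k) * X k) with hv
  have hvk : v k = X k := by
    simp [hv, Function.update_of_ne hik.symm, Function.update_of_ne hjk.symm]
  have hvi : v i = C (p i / p k) * X k := by
    simp [hv, Function.update_of_ne hij]
  have hvj : v j = C (p j / p k) * X k := by
    simp [hv]
  have hi : aeval v (pointForm p k i) = 0 := by
    simp [pointForm, hvi, hvk, algebraMap_eq]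
  have hj : aeval v (pointForm p k j) = 0 := by
    simp [pointForm, hvj, hvk, algebraMap_eq]
  have hfv : aeval v f ≠ 0 := by
    intro h0
    -- The substitution restricts to a space containing `p`, hence cannot kill `f`.
    have hcomp : (aeval p).comp (aeval v) = (aeval p : MvPolynomial σ K →ₐ[K] K) := by
      refine MvPolynomial.algHom_ext fun l => ?_
      by_cases hlj : l = j
      · subst hlj
        simp [hvj, hk]
      by_cases hli : l = i
      · subst hli
        simp [hvi, hk]
      simp [hv, Function.update_of_ne hlj, Function.update_of_ne hli]
    have := DFunLike.congr_fun hcomp f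
    rw [AlgHom.comp_apply, h0, map_zero, aeval_eq_eval] at this
    exact hf this.symm
  obtain ⟨a, b, hab⟩ := Ideal.mem_span_pair.mp h
  have h1 := congrArg (aeval v) hab
  rw [map_add, map_mul, map_mul, map_mul, hi, hj, mul_zero, mul_zero, add_zero, eq_comm,
    mul_eq_zero] at h1
  have hc := h1.resolve_right hfv
  have hmem := sub_aeval_mem (I := Ideal.span {pointForm p k i, pointForm p k j}) (v := v)
    (fun l => ?_) c
  · rwa [hc, sub_zero] at hmem
  · by_cases hlj : l = j
    · subst hlj
      rw [hvj]
      exact Ideal.subset_span (Or.inr rfl)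
    by_cases hli : l = i
    · subst hli
      rw [hvi]
      exact Ideal.subset_span (Or.inl rfl)
    simp [hv, Function.update_of_ne hlj, Function.update_of_ne hli]

/-- A hands-on depth computation. Cross-multiplying the two relations and cancelling `g` modulo `f`
gives a syzygy of the linear forms `l₁, l₂` modulo `f`. As `f(p) ≠ 0` while both forms vanish at
`p`, this syzygy is trivial, and `l₁` can be cancelled from the first relation. -/
theorem MvPolynomial.mem_span_pair_of_pointForm_mul_mem (hk : p k ≠ 0) (hik : i ≠ k) (hjk : j ≠ k)
    (hij : i ≠ j) {f g h : MvPolynomial σ K} (hf : Irreducible f) (hfg : ¬ f ∣ g)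
    (hfp : eval p f ≠ 0) (hi : pointForm p k i * h ∈ Ideal.span {f, g})
    (hj : pointForm p k j * h ∈ Ideal.span {f, g}) : h ∈ Ideal.span {f, g} := by
  have hfprime : Prime f := hf.prime
  obtain ⟨u, w, hi⟩ := Ideal.mem_span_pair.mp hi
  obtain ⟨u', w', hj⟩ := Ideal.mem_span_pair.mp hj
  set l₁ := pointForm p k i
  set l₂ := pointForm p k j
  obtain ⟨c, hc⟩ : f ∣ l₂ * w - l₁ * w' := by
    refine (hfprime.dvd_or_dvd (b := g) ⟨l₁ * u' - l₂ * u, ?_⟩).resolve_right hfg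
    linear_combination l₂ * hi - l₁ * hj
  have hcm : c ∈ Ideal.span {l₁, l₂} :=
    mem_span_pointForm_of_mul_mem hk hik hjk hij hfp
      (Ideal.mem_span_pair.mpr ⟨-w', w, by linear_combination hc⟩)
  obtain ⟨c₁, c₂, hc12⟩ := Ideal.mem_span_pair.mp hcm
  obtain ⟨t, ht⟩ : l₁ ∣ w - c₂ * f :=
    pointForm_dvd_of_mul_eq_mul (u := w' + c₁ * f) hik hjk hij
      (by linear_combination hc - f * hc12)
  have hdvd : f ∣ l₁ * (h - t * g) := ⟨u + c₂ * g, by linear_combination - hi + g * ht⟩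
  have hnd : ¬ f ∣ l₁ := by
    intro hd
    obtain ⟨c, hc⟩ := hf.exists_eq_mul_C_of_dvd (pointForm_ne_zero hik)
      (totalDegree_pointForm_le i) hd
    have hcp := congrArg (eval p) hc
    rw [eval_pointForm hk, map_mul, eval_C, eq_comm, mul_eq_zero] at hcp
    refine pointForm_ne_zero (p := p) hik ?_
    rw [hc, hcp.resolve_left hfp, map_zero, mul_zero]
  obtain ⟨q, hq⟩ := (hfprime.dvd_or_dvd hdvd).resolve_left hnd
  exact Ideal.mem_span_pair.mpr ⟨q, t, by linear_combination -hq⟩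

theorem Ideal.mem_of_pow_mul_mem {R : Type*} [CommRing R] {I : Ideal R} {l₁ l₂ : R}
    (hI : ∀ h, l₁ * h ∈ I → l₂ * h ∈ I → h ∈ I) (a b : ℕ) :
    ∀ h, l₁ ^ a * h ∈ I → l₂ ^ b * h ∈ I → h ∈ I := by
  induction a generalizing b with
  | zero => intro h h1 _; simpa using h1
  | succ a iha =>
    induction b with
    | zero => intro h _ h2; simpa using h2
    | succ b ihb =>
      intro h h1 h2
      refine hI h (iha (b + 1) _ ?_ ?_) (ihb _ ?_ ?_)
      · rwa [← mul_assoc, ← pow_succ]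
      · rw [mul_left_comm]; exact I.mul_mem_left _ h2
      · rw [mul_left_comm]; exact I.mul_mem_left _ h1
      · rwa [← mul_assoc, ← pow_succ]

variable [IsAlgClosed K] [Fintype σ]

/-- The colon ideal of `h` has no zero outside the origin, so by the Nullstellensatz it contains
powers of two linear forms, which can then be cancelled one factor at a time. -/
theorem MvPolynomial.mem_span_pair_of_forall_exists (hσ : 2 < Fintype.card σ)
    {f g h : MvPolynomial σ K} (hf : Irreducible f) (hfg : ¬ f ∣ g) (hf0 : eval 0 f = 0)
    (hloc : ∀ x : σ → K, x ≠ 0 → ∃ s, eval x s ≠ 0 ∧ s * h ∈ Ideal.span {f, g}) :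
    h ∈ Ideal.span {f, g} := by
  classical
  obtain ⟨p, hp⟩ : ∃ p, eval p f ≠ 0 := by
    by_contra! hall
    exact hf.ne_zero (MvPolynomial.funext fun x => by simpa using hall x)
  obtain ⟨k, hk⟩ : ∃ k, p k ≠ 0 := by
    by_contra! hall
    exact hp (by rwa [show p = 0 from _root_.funext hall])
  -- Three variables are needed here: two indices besides `k`.
  obtain ⟨i, hi, j, hj, hij⟩ := Finset.one_lt_card.mp
    (show 1 < (Finset.univ.erase k).card by
      rw [Finset.card_erase_of_mem (Finset.mem_univ _), Finset.card_univ]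
      omega)
  have hrad : ∀ l : MvPolynomial σ K, eval 0 l = 0 →
      ∃ a : ℕ, l ^ a * h ∈ Ideal.span {f, g} := by
    intro l hl
    set J : Ideal (MvPolynomial σ K) :=
      Submodule.comap (LinearMap.mulRight (MvPolynomial σ K) h) (Ideal.span {f, g}) with hJ
    have : l ∈ J.radical := by
      rw [← vanishingIdeal_zeroLocus_eq_radical (K := K), mem_vanishingIdeal_iff]
      intro x hx
      by_cases hx0 : x = 0
      · rw [hx0]; simpa using hl
      · obtain ⟨s, hs, hsh⟩ := hloc x hx0
        refine absurd ?_ hs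
        simpa using hx s hsh
    obtain ⟨a, ha⟩ := this
    exact ⟨a, ha⟩
  obtain ⟨a, ha⟩ := hrad _ (eval_zero_pointForm (p := p) (k := k) i)
  obtain ⟨b, hb⟩ := hrad _ (eval_zero_pointForm (p := p) (k := k) j)
  exact Ideal.mem_of_pow_mul_mem (fun h' => mem_span_pair_of_pointForm_mul_mem hk
    (Finset.ne_of_mem_erase hi) (Finset.ne_of_mem_erase hj) hij hf hfg hp) a b h ha hb

theorem MvPolynomial.mem_span_pair_of_eval_eq_zero (hσ : 2 < Fintype.card σ)
    {f g h : MvPolynomial σ K} (hf : Irreducible f) (hfg : ¬ f ∣ g) (hf0 : eval 0 f = 0)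
    (htr : ∀ x : σ → K, x ≠ 0 → eval x f = 0 → eval x g = 0 → LinearIndependent K
      ![fun j => eval x (pderiv j f), fun j => eval x (pderiv j g)])
    (hh : ∀ x, eval x f = 0 → eval x g = 0 → eval x h = 0) : h ∈ Ideal.span {f, g} := by
  refine mem_span_pair_of_forall_exists hσ hf hfg hf0 fun x hx => ?_
  by_cases hfx : eval x f = 0
  swap
  · exact ⟨f, hfx, Ideal.mul_mem_right _ _ (Ideal.subset_span (Or.inl rfl))⟩
  by_cases hgx : eval x g = 0
  swap
  · exact ⟨g, hgx, Ideal.mul_mem_right _ _ (Ideal.subset_span (Or.inr rfl))⟩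
  obtain ⟨Q, hQ, hQiff⟩ := exists_isPrime_of_linearIndependent hfx hgx (htr x hx hfx hgx)
  have hrad : h ∈ (Ideal.span {f, g}).radical := by
    rw [← vanishingIdeal_zeroLocus_eq_radical (K := K), mem_vanishingIdeal_iff]
    intro y hy
    have h1 := hy f (Ideal.subset_span (Or.inl rfl))
    have h2 := hy g (Ideal.subset_span (Or.inr rfl))
    rw [aeval_eq_eval] at *
    exact hh y h1 h2
  obtain ⟨N, hN⟩ := hrad
  exact (hQiff h).mp (hQ.mem_of_pow_mem N ((hQiff _).mpr ⟨1, by simp, by simpa using hN⟩))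

/-- If `k` lay in the local prime at `x`, differentiating `s * k = a * f + b * g` at `x` would give
a linear relation among the three gradients with coefficient `-s(x) ≠ 0`. -/
theorem MvPolynomial.mem_span_pair_of_mul_mem (hσ : 2 < Fintype.card σ)
    {f g k h : MvPolynomial σ K} (hf : Irreducible f) (hfg : ¬ f ∣ g) (hf0 : eval 0 f = 0)
    (htr : ∀ x : σ → K, x ≠ 0 → eval x f = 0 → eval x g = 0 → LinearIndependent K
      ![fun j => eval x (pderiv j f), fun j => eval x (pderiv j g)])
    (htr3 : ∀ x : σ → K, x ≠ 0 → eval x f = 0 → eval x g = 0 → eval x k = 0 →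
      LinearIndependent K ![fun j => eval x (pderiv j f), fun j => eval x (pderiv j g),
        fun j => eval x (pderiv j k)])
    (hkh : k * h ∈ Ideal.span {f, g}) : h ∈ Ideal.span {f, g} := by
  refine mem_span_pair_of_forall_exists hσ hf hfg hf0 fun x hx => ?_
  by_cases hfx : eval x f = 0
  swap
  · exact ⟨f, hfx, Ideal.mul_mem_right _ _ (Ideal.subset_span (Or.inl rfl))⟩
  by_cases hgx : eval x g = 0
  swap
  · exact ⟨g, hgx, Ideal.mul_mem_right _ _ (Ideal.subset_span (Or.inr rfl))⟩
  obtain ⟨Q, hQ, hQiff⟩ := exists_isPrime_of_linearIndependent hfx hgx (htr x hx hfx hgx)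
  refine (hQiff h).mp ((hQ.mem_or_mem ((hQiff _).mpr ⟨1, by simp, by simpa using hkh⟩)).resolve_left
    fun hk => ?_)
  obtain ⟨s, hs, hsk⟩ := (hQiff k).mp hk
  obtain ⟨a, b, hab⟩ := Ideal.mem_span_pair.mp hsk
  have hkx : eval x k = 0 := by
    have := congrArg (eval x) hab
    simpa [hfx, hgx, hs] using this
  have hli := Fintype.linearIndependent_iff.mp (htr3 x hx hfx hgx hkx)
    ![eval x a, eval x b, - eval x s] (by
      ext j
      have h1 := congrArg (fun u => eval x (pderiv j u)) hab
      simp [Derivation.leibniz, hfx, hgx, hkx] at h1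
      simp [Fin.sum_univ_three, ← h1]) 2
  exact hs (by simpa using hli)

end Saturation

/-! ### The ideal generated by the products omitting one factor. -/

section NormalCrossingIdeals

open MvPolynomial

theorem MvPolynomial.IsHomogeneous.eval_smul {σ R : Type*} [CommRing R]
    {a : MvPolynomial σ R} {e : ℕ} (ha : a.IsHomogeneous e) (t : R) (x : σ → R) :
    eval (t • x) a = t ^ e * eval x a := by
  rw [eval_eq, eval_eq, Finset.mul_sum]
  refine Finset.sum_congr rfl fun d hd => ?_
  simp only [Pi.smul_apply, smul_eq_mul, mul_pow, Finset.prod_mul_distrib, Finset.prod_pow_eq_pow_sum]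
  rw [← ha.degree_eq_sum_deg_support hd]
  ring

theorem MvPolynomial.IsHomogeneous.homogeneousComponent_mul {σ R : Type*} [CommRing R]
    {a : MvPolynomial σ R} {d : ℕ} (ha : a.IsHomogeneous d) (e : ℕ) (b : MvPolynomial σ R) :
    homogeneousComponent (d + e) (a * b) = a * homogeneousComponent e b := by
  let _ := gradedAlgebra (σ := σ) (R := R)
  have hc (φ : MvPolynomial σ R) (i : ℕ) :
      (DirectSum.decompose (homogeneousSubmodule σ R) φ i : MvPolynomial σ R) =
        homogeneousComponent i φ := decomposition.decompose'_apply φ i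
  rw [← hc, ← hc]
  exact DirectSum.coe_decompose_mul_add_of_left_mem (homogeneousSubmodule σ R) ha

theorem MvPolynomial.IsHomogeneous.of_mul_left {σ R : Type*} [CommRing R] [IsDomain R]
    {a b : MvPolynomial σ R} {d e : ℕ} (ha : a.IsHomogeneous d) (ha0 : a ≠ 0)
    (hab : (a * b).IsHomogeneous (d + e)) : b.IsHomogeneous e := by
  have h := ha.homogeneousComponent_mul e b
  rw [homogeneousComponent_eq_self hab] at h
  rw [mul_left_cancel₀ ha0 h]
  exact homogeneousComponent_isHomogeneous e b

variable {σ K : Type*} [Field K]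

/-- In two variables the substitution restricts `G` to the line spanned by `p`, where `G` vanishes
by homogeneity. -/
theorem MvPolynomial.IsHomogeneous.pointForm_dvd [Infinite K] {p : σ → K} {i k : σ} (hk : p k ≠ 0)
    (hik : i ≠ k) (hσ : ∀ l, l = i ∨ l = k) {G : MvPolynomial σ K} {e : ℕ}
    (hG : G.IsHomogeneous e) (hGp : eval p G = 0) : pointForm p k i ∣ G := by
  classical
  set v : σ → MvPolynomial σ K := Function.update X i (C (p i / p k) * X k) with hv
  have hmem := sub_aeval_mem (I := Ideal.span {pointForm p k i}) (v := v) (fun l => ?_) G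
  · have h0 : MvPolynomial.aeval v G = 0 := by
      refine MvPolynomial.funext fun x => ?_
      have hcomp : eval x (MvPolynomial.aeval v G) = eval (fun l => eval x (v l)) G := by
        have hc : (MvPolynomial.aeval x).comp (MvPolynomial.aeval v) =
            (MvPolynomial.aeval (fun l => eval x (v l)) : MvPolynomial σ K →ₐ[K] K) :=
          algHom_ext fun l => by simp [aeval_eq_eval]
        exact DFunLike.congr_fun hc G
      have hy : (fun l => eval x (v l)) = (x k / p k) • p := by
        ext l
        rcases hσ l with rfl | rfl
        · simp [hv]; ring
        · simp [hv, Function.update_of_ne hik.symm, hk]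
      rw [hcomp, hy, hG.eval_smul, hGp, mul_zero, map_zero]
    rwa [h0, sub_zero, Ideal.mem_span_singleton] at hmem
  · by_cases hl : l = i
    · subst hl
      have : X l - v l = pointForm p k l := by simp [hv, pointForm]
      rw [this]
      exact Ideal.mem_span_singleton_self _
    · simp [hv, Function.update_of_ne hl]

theorem Irreducible.associated_pointForm [Infinite K] {p : σ → K} {i k : σ} (hk : p k ≠ 0)
    (hik : i ≠ k) (hσ : ∀ l, l = i ∨ l = k) {F : MvPolynomial σ K} {e : ℕ} (hF : Irreducible F)
    (hFe : F.IsHomogeneous e) (hFp : eval p F = 0) : Associated (pointForm p k i) F := by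
  obtain ⟨q, hq⟩ := hFe.pointForm_dvd hk hik hσ hFp
  have hnu : ¬ IsUnit (pointForm p k i) := by
    intro h
    have := h.map (eval (0 : σ → K))
    rw [eval_zero_pointForm] at this
    exact not_isUnit_zero this
  have hu := (hF.isUnit_or_isUnit hq).resolve_left hnu
  exact ⟨hu.unit, hq.symm⟩

/-- Otherwise the Nullstellensatz makes `F` divide every variable, so two distinct variables would
be proportional. -/
theorem Irreducible.exists_ne_zero_eval_eq_zero [IsAlgClosed K] [Finite σ] [Nontrivial σ]
    {F : MvPolynomial σ K} (hF : Irreducible F) : ∃ x : σ → K, x ≠ 0 ∧ eval x F = 0 := by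
  classical
  by_contra! hall
  have hdvd : ∀ i, ∃ c, X i = F * C c := by
    intro i
    refine hF.exists_eq_mul_C_of_dvd (X_ne_zero i) (totalDegree_X i).le ?_
    have hrad : X i ∈ (Ideal.span {F}).radical := by
      rw [← vanishingIdeal_zeroLocus_eq_radical (K := K), mem_vanishingIdeal_iff]
      intro x hx
      have h1 := hx F (Ideal.mem_span_singleton_self F)
      by_cases hx0 : x = 0
      · simp [hx0]
      · rw [aeval_eq_eval] at h1
        exact absurd h1 (hall x hx0)
    obtain ⟨N, hN⟩ := hrad
    exact hF.prime.dvd_of_dvd_pow (Ideal.mem_span_singleton.mp hN)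
  obtain ⟨i, j, hij⟩ := exists_pair_ne σ
  obtain ⟨c, hc⟩ := hdvd i
  obtain ⟨c', hc'⟩ := hdvd j
  have h : X i * C c' = X j * C c := by rw [hc, hc']; ring
  have h1 := congrArg (eval (Pi.single i (1 : K))) h
  simp [hij.symm] at h1
  rw [h1, map_zero, mul_zero] at hc'
  exact X_ne_zero j hc'

theorem MvPolynomial.not_dvd_of_linearIndependent [IsAlgClosed K] [Finite σ] [Nontrivial σ]
    {f g : MvPolynomial σ K} (hf : Irreducible f)
    (htr : ∀ x : σ → K, x ≠ 0 → eval x f = 0 → eval x g = 0 → LinearIndependent K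
      ![fun j => eval x (pderiv j f), fun j => eval x (pderiv j g)]) : ¬ f ∣ g := by
  rintro ⟨q, rfl⟩
  obtain ⟨x, hx, hfx⟩ := hf.exists_ne_zero_eval_eq_zero
  have h := LinearIndependent.pair_iff.mp (htr x hx hfx (by simp [hfx])) (-eval x q) 1 (by
    ext j
    simp [Derivation.leibniz, hfx])
  exact one_ne_zero h.2

/-- Adding an index `m` to `T`, write `a` as `∏_T F_i * c + F m * b`. Modulo `(F i, F j)` the
product vanishes and `F m` cancels, so the induction hypothesis applies to `b`. -/
theorem exists_eq_sum_prod_erase_mul {S ι : Type*} [CommRing S] [DecidableEq ι] (F : ι → S)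
    (T : Finset ι) (hT : T.Nonempty)
    (hreg : ∀ i ∈ T, ∀ j ∈ T, ∀ k ∈ T, i ≠ j → k ≠ i → k ≠ j → ∀ b,
      F k * b ∈ Ideal.span {F i, F j} → b ∈ Ideal.span {F i, F j}) (a : S)
    (ha : ∀ i ∈ T, ∀ j ∈ T, i ≠ j → a ∈ Ideal.span {F i, F j}) :
    ∃ c : ι → S, a = ∑ i ∈ T, (∏ j ∈ T.erase i, F j) * c i := by
  induction hT using Finset.Nonempty.cons_induction generalizing a with
  | singleton i => exact ⟨fun _ => a, by simp⟩
  | cons m T hm hT ih =>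
    have hmT : ∀ i ∈ T, i ≠ m := fun i hi h => hm (h ▸ hi)
    have hsub : ∀ i ∈ T, i ∈ Finset.cons m T hm := fun i hi => Finset.mem_cons_of_mem hi
    have hmm : m ∈ Finset.cons m T hm := Finset.mem_cons_self m T
    have hcancel : ∀ u ∈ T, ∀ U ⊆ T, u ∉ U → ∀ b, (∏ i ∈ U, F i) * b ∈ Ideal.span {F u, F m} →
        b ∈ Ideal.span {F u, F m} := by
      intro u hu U
      induction U using Finset.induction_on with
      | empty => intro _ _ b hb; simpa using hb
      | insert w U hw ihU =>
        intro hUT huU b hb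
        rw [Finset.insert_subset_iff] at hUT
        rw [Finset.mem_insert, not_or] at huU
        rw [Finset.prod_insert hw, mul_assoc] at hb
        exact ihU hUT.2 huU.2 b (hreg u (hsub u hu) m hmm w (hsub w hUT.1) (hmT u hu)
          (Ne.symm huU.1) (hmT w hUT.1) _ hb)
    -- Factors are peeled off one at a time: modulo `(F u, F m)` the earlier factors cancel, so the
    -- current cofactor acquires a factor `F u` up to a multiple of `F m`.
    have hdec : ∀ U ⊆ T, ∃ c b, a = (∏ i ∈ U, F i) * c + F m * b := by
      intro U
      induction U using Finset.induction_on with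
      | empty => intro _; exact ⟨a, 0, by simp⟩
      | insert u U hu ihU =>
        intro hUT
        rw [Finset.insert_subset_iff] at hUT
        obtain ⟨c, b, hcb⟩ := ihU hUT.2
        have hau := ha u (hsub u hUT.1) m hmm (hmT u hUT.1)
        have hc : c ∈ Ideal.span {F u, F m} := by
          refine hcancel u hUT.1 U hUT.2 hu c ?_
          have h1 : (∏ i ∈ U, F i) * c = a - b * F m := by rw [hcb]; ring
          rw [h1]
          exact sub_mem hau (Ideal.mul_mem_left _ _ (Ideal.subset_span (Or.inr rfl)))
        obtain ⟨c₁, c₂, rfl⟩ := Ideal.mem_span_pair.mp hc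
        refine ⟨c₁, b + (∏ i ∈ U, F i) * c₂, ?_⟩
        rw [hcb, Finset.prod_insert hu]
        ring
    obtain ⟨c, b, hcb⟩ := hdec T subset_rfl
    obtain ⟨c', hc'⟩ := ih (fun i hi j hj k hk => hreg i (hsub i hi) j (hsub j hj) k (hsub k hk)) b
      (fun i hi j hj hij => by
        refine hreg i (hsub i hi) j (hsub j hj) m hmm hij (hmT i hi).symm (hmT j hj).symm b ?_
        have h1 : F m * b = a - (∏ i ∈ T, F i) * c := by rw [hcb]; ring
        rw [h1]
        refine sub_mem (ha i (hsub i hi) j (hsub j hj) hij) ?_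
        rw [← Finset.mul_prod_erase T F hi, mul_assoc]
        exact Ideal.mul_mem_right _ _ (Ideal.subset_span (Or.inl rfl)))
    refine ⟨Function.update c' m c, ?_⟩
    rw [Finset.sum_cons, Finset.erase_cons, Function.update_self, hcb, hc', Finset.mul_sum]
    congr 1
    refine Finset.sum_congr rfl fun i hi => ?_
    rw [Function.update_of_ne (hmT i hi), Finset.cons_eq_insert,
      Finset.erase_insert_of_ne (hmT i hi).symm,
      Finset.prod_insert (fun h => hm (Finset.mem_of_mem_erase h)), mul_assoc]

theorem MvPolynomial.IsHomogeneous.eq_C_mul_X_pow [Infinite K] {i : σ} (hσ : ∀ l, l = i)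
    {G : MvPolynomial σ K} {e : ℕ} (hG : G.IsHomogeneous e) : G = C (eval 1 G) * X i ^ e := by
  refine MvPolynomial.funext fun x => ?_
  have hx : x = x i • 1 := by
    ext l
    simp [hσ l]
  rw [hx, hG.eval_smul]
  simp [mul_comm]

/-- Newton-style interpolation: irreducible binary forms are linear, and each step removes one root.
-/
theorem exists_eq_sum_prod_erase_mul_of_card_eq_two {ι : Type*} [DecidableEq ι] [IsAlgClosed K]
    [Fintype σ] (hσ : Fintype.card σ = 2) (F : ι → MvPolynomial σ K) (deg : ι → ℕ)
    (hirr : ∀ i, Irreducible (F i)) (hF : ∀ i, (F i).IsHomogeneous (deg i))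
    (hdvd : ∀ i j, i ≠ j → ¬ F i ∣ F j) (T : Finset ι) (hT : T.Nonempty)
    (a : MvPolynomial σ K) (ha : a.IsHomogeneous (∑ i ∈ T, deg i - 1)) :
    ∃ c : ι → MvPolynomial σ K, a = ∑ i ∈ T, (∏ j ∈ T.erase i, F j) * c i := by
  have : Nontrivial σ := Fintype.one_lt_card_iff_nontrivial.mp (by omega)
  have hpt : ∀ i, ∃ (p : σ → K) (k l : σ), p k ≠ 0 ∧ l ≠ k ∧ (∀ j, j = l ∨ j = k) ∧
      eval p (F i) = 0 := by
    intro i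
    obtain ⟨p, hp, hFp⟩ := (hirr i).exists_ne_zero_eval_eq_zero
    obtain ⟨k, hk⟩ := Function.ne_iff.mp hp
    obtain ⟨l, hl⟩ := exists_ne k
    refine ⟨p, k, l, hk, hl, fun j => ?_, hFp⟩
    classical
    by_contra! hj
    have := Finset.card_le_univ ({j, l, k} : Finset σ)
    rw [Finset.card_eq_three.mpr ⟨j, l, k, hj.1, hj.2, hl, rfl⟩] at this
    omega
  choose p k l hk hlk hcov hFp using hpt
  have hass : ∀ i, Associated (pointForm (p i) (k i) (l i)) (F i) := fun i =>
    (hirr i).associated_pointForm (hk i) (hlk i) (hcov i) (hF i) (hFp i)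
  have hdvd' : ∀ i (G : MvPolynomial σ K) (e : ℕ), G.IsHomogeneous e → eval (p i) G = 0 →
      F i ∣ G := fun i G e hG hGp =>
    (hass i).symm.dvd.trans (hG.pointForm_dvd (hk i) (hlk i) (hcov i) hGp)
  have hdeg : ∀ i, deg i = 1 := by
    intro i
    refine le_antisymm ?_ (Nat.one_le_iff_ne_zero.mpr fun h0 => ?_)
    · rw [← (hF i).totalDegree (hirr i).ne_zero]
      refine le_trans ?_ (totalDegree_pointForm_le (p := p i) (k := k i) (l i))
      exact totalDegree_le_of_dvd_of_isDomain (hass i).symm.dvd (pointForm_ne_zero (hlk i))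
    · refine (hirr i).totalDegree_ne_zero ?_
      rw [(hF i).totalDegree (hirr i).ne_zero, h0]
  simp only [hdeg, Finset.sum_const, smul_eq_mul, mul_one] at ha
  induction hT using Finset.Nonempty.cons_induction generalizing a with
  | singleton i => exact ⟨fun _ => a, by simp⟩
  | cons m T hm hT ih =>
    have hmT : ∀ i ∈ T, i ≠ m := fun i hi h => hm (h ▸ hi)
    rw [Finset.card_cons, Nat.add_sub_cancel] at ha
    have hprod : (∏ i ∈ T, F i).IsHomogeneous T.card := by
      have := IsHomogeneous.prod T F deg fun i _ => hF i
      simpa [hdeg] using this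
    have hne : eval (p m) (∏ i ∈ T, F i) ≠ 0 := by
      rw [eval_prod, Finset.prod_ne_zero_iff]
      exact fun i hi h0 => hdvd m i (hmT i hi).symm (hdvd' m _ _ (hF i) h0)
    -- Chosen so that `a - t ∏_T F_i` vanishes at `p m` and is divisible by `F m`.
    set t := eval (p m) a / eval (p m) (∏ i ∈ T, F i) with ht
    obtain ⟨b, hb⟩ := hdvd' m (a - C t * ∏ i ∈ T, F i) _ (ha.sub (hprod.C_mul t)) (by
      simp only [map_sub, map_mul, eval_C, ht]
      field_simp
      ring)
    have hbh : b.IsHomogeneous (T.card - 1) := by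
      refine (hF m).of_mul_left (hirr m).ne_zero ?_
      rw [← hb, hdeg, Nat.add_sub_cancel' (Finset.card_pos.mpr hT)]
      exact ha.sub (hprod.C_mul t)
    obtain ⟨c', hc'⟩ := ih b hbh
    refine ⟨Function.update c' m (C t), ?_⟩
    rw [Finset.sum_cons, Finset.erase_cons, Function.update_self]
    have hsum : ∑ i ∈ T, (∏ j ∈ (Finset.cons m T hm).erase i, F j) *
        Function.update c' m (C t) i = F m * b := by
      rw [hc', Finset.mul_sum]
      refine Finset.sum_congr rfl fun i hi => ?_
      rw [Function.update_of_ne (hmT i hi), Finset.cons_eq_insert,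
        Finset.erase_insert_of_ne (hmT i hi).symm,
        Finset.prod_insert (fun h => hm (Finset.mem_of_mem_erase h)), mul_assoc]
    rw [hsum, ← hb]
    ring

end NormalCrossingIdeals

/-! ### Coefficients and radial contraction of one-forms. -/

namespace LogForms

section Forms

variable {n m : ℕ}

@[simp] theorem formCoeff_add (α β : OneForm n) (j : Fin (n + 1)) :
    formCoeff (α + β) j = formCoeff α j + formCoeff β j := by
  simp [formCoeff]

@[simp] theorem formCoeff_sub (α β : OneForm n) (j : Fin (n + 1)) :
    formCoeff (α - β) j = formCoeff α j - formCoeff β j := by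
  simp [formCoeff]

@[simp] theorem formCoeff_smul (f : PolyRing n) (α : OneForm n) (j : Fin (n + 1)) :
    formCoeff (f • α) j = f * formCoeff α j := by
  simp [formCoeff]

theorem C_smul_form (c : ℂ) (α : OneForm n) : (C c : PolyRing n) • α = c • α := by
  rw [← algebraMap_eq, algebraMap_smul]

@[simp] theorem formCoeff_complex_smul (c : ℂ) (α : OneForm n) (j : Fin (n + 1)) :
    formCoeff (c • α) j = C c * formCoeff α j := by
  rw [← C_smul_form, formCoeff_smul]

@[simp] theorem formCoeff_sum {ι : Type*} (s : Finset ι) (α : ι → OneForm n) (j : Fin (n + 1)) :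
    formCoeff (∑ i ∈ s, α i) j = ∑ i ∈ s, formCoeff (α i) j := by
  simp [formCoeff, Finsupp.finsetSum_apply]

@[simp] theorem formCoeff_extD (G : PolyRing n) (j : Fin (n + 1)) :
    formCoeff (extD G) j = pderiv j G := by
  simp [formCoeff, extD, mvPolynomialBasis_repr_apply]

theorem form_ext {α β : OneForm n} (h : ∀ j, formCoeff α j = formCoeff β j) : α = β :=
  (mvPolynomialBasis ℂ (Fin (n + 1))).repr.injective (Finsupp.ext h)

/-- The one-form with given coefficients. -/
noncomputable def formOfCoeff (a : Fin (n + 1) → PolyRing n) : OneForm n :=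
  (mvPolynomialBasis ℂ (Fin (n + 1))).repr.symm (Finsupp.equivFunOnFinite.symm a)

@[simp] theorem formCoeff_formOfCoeff (a : Fin (n + 1) → PolyRing n) (j : Fin (n + 1)) :
    formCoeff (formOfCoeff a) j = a j := by
  simp [formCoeff, formOfCoeff]

theorem radialContraction_add (α β : OneForm n) :
    radialContraction (α + β) = radialContraction α + radialContraction β := by
  simp [radialContraction, add_mul, Finset.sum_add_distrib]

theorem radialContraction_sub (α β : OneForm n) :
    radialContraction (α - β) = radialContraction α - radialContraction β := by
  simp [radialContraction, sub_mul, Finset.sum_sub_distrib]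

theorem radialContraction_smul (f : PolyRing n) (α : OneForm n) :
    radialContraction (f • α) = f * radialContraction α := by
  simp [radialContraction, Finset.mul_sum, mul_assoc]

theorem radialContraction_complex_smul (c : ℂ) (α : OneForm n) :
    radialContraction (c • α) = C c * radialContraction α := by
  rw [← C_smul_form, radialContraction_smul]

theorem radialContraction_sum {ι : Type*} (s : Finset ι) (α : ι → OneForm n) :
    radialContraction (∑ i ∈ s, α i) = ∑ i ∈ s, radialContraction (α i) := by
  simp only [radialContraction, formCoeff_sum, Finset.sum_mul]
  exact Finset.sum_comm

/-- Euler's identity for the contraction of an exact form. -/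
theorem radialContraction_extD {G : PolyRing n} {d : ℕ} (hG : G.IsHomogeneous d) :
    radialContraction (extD G) = C (d : ℂ) * G := by
  have := hG.sum_X_mul_pderiv
  simp only [radialContraction, formCoeff_extD]
  rw [map_natCast, ← nsmul_eq_mul, ← this]
  exact Finset.sum_congr rfl fun j _ => mul_comm _ _

theorem isFormOfDegree_iff {d : ℕ} (hd : d ≠ 0) {α : OneForm n} :
    IsFormOfDegree d α ↔ ∀ j, (formCoeff α j).IsHomogeneous (d - 1) := by
  simp [IsFormOfDegree, hd]

theorem IsFormOfDegree.radialContraction {d : ℕ} {α : OneForm n} (hα : IsFormOfDegree d α) :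
    (radialContraction α).IsHomogeneous d := by
  refine IsHomogeneous.sum _ _ _ fun j _ => ?_
  rcases Nat.eq_zero_or_pos d with rfl | hd
  · rw [(hα j).2 rfl, zero_mul]
    exact isHomogeneous_zero _ _ _
  · have := (hα j).1.mul (isHomogeneous_X ℂ j)
    rwa [Nat.sub_add_cancel hd] at this

variable {deg : Fin m → ℕ} {F : Fin m → PolyRing n}

theorem mul_hatProd (F : Fin m → PolyRing n) (i : Fin m) : F i * hatProd F i = ∏ j, F j :=
  Finset.mul_prod_erase _ _ (Finset.mem_univ i)

theorem hatProd_isHomogeneous (hF : ∀ i, (F i).IsHomogeneous (deg i)) (i : Fin m) :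
    (hatProd F i).IsHomogeneous (∑ j, deg j - deg i) := by
  have := IsHomogeneous.prod (Finset.univ.erase i) F deg fun j _ => hF j
  rwa [← Finset.add_sum_erase _ deg (Finset.mem_univ i), Nat.add_sub_cancel_left]

theorem eval_hatProd_eq_zero {x : Fin (n + 1) → ℂ} (hx : x ∈ coneStratum F 2) (i : Fin m) :
    eval x (hatProd F i) = 0 := by
  obtain ⟨A, hA, hAx⟩ := hx
  obtain ⟨j, hj, hji⟩ := Finset.exists_mem_ne (by omega : 1 < A.card) i
  rw [hatProd, eval_prod]
  exact Finset.prod_eq_zero (Finset.mem_erase.mpr ⟨hji, Finset.mem_univ j⟩) (hAx j hj)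

theorem mem_coneStratum_two {x : Fin (n + 1) → ℂ} {i j : Fin m} (hij : i ≠ j)
    (hi : eval x (F i) = 0) (hj : eval x (F j) = 0) : x ∈ coneStratum F 2 :=
  ⟨{i, j}, Finset.card_pair hij, by simp [hi, hj]⟩

theorem vanishesOnAffine_sum_hatProd_smul (β : Fin m → OneForm n) :
    VanishesOnAffine (∑ i, hatProd F i • β i) (coneStratum F 2) := by
  intro x hx
  ext j
  simp [formValue, eval_hatProd_eq_zero hx]

theorem deg_ne_zero (hF : ∀ i, (F i).IsHomogeneous (deg i)) (hirr : ∀ i, Irreducible (F i))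
    (i : Fin m) : deg i ≠ 0 := by
  intro h
  exact (hirr i).totalDegree_ne_zero (by rw [(hF i).totalDegree (hirr i).ne_zero, h])

theorem eval_zero_eq_zero {a : PolyRing n} {d : ℕ} (ha : a.IsHomogeneous d) (hd : d ≠ 0) :
    eval 0 a = 0 := by
  have := ha.eval_smul 0 0
  rwa [zero_smul, zero_pow hd, zero_mul] at this

/-! ### Decomposition along a normal crossings divisor. -/

theorem NormalCrossings.linearIndependent_comp (hnc : NormalCrossings F) {r : ℕ}
    (s : Fin r → Fin m) (hs : Function.Injective s) {x : Fin (n + 1) → ℂ} (hx : x ≠ 0)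
    (h : ∀ t, eval x (F (s t)) = 0) :
    LinearIndependent ℂ fun t j => eval x (pderiv j (F (s t))) := by
  have hval : ∀ i, formValue (extD (F i)) x = fun j => eval x (pderiv j (F i)) := fun i => by
    ext j
    rw [formValue, formCoeff_extD]
  rw [show (fun t j => eval x (pderiv j (F (s t)))) = fun t => formValue (extD (F (s t))) x from
    funext fun t => (hval (s t)).symm]
  exact (hnc.transversal x hx).comp (fun t => ⟨s t, h t⟩)
    (fun t u htu => hs (congrArg Subtype.val htu))

theorem NormalCrossings.linearIndependent_pair (hnc : NormalCrossings F) {i j : Fin m}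
    (hij : i ≠ j) (x : Fin (n + 1) → ℂ) (hx : x ≠ 0) (hi : eval x (F i) = 0)
    (hj : eval x (F j) = 0) : LinearIndependent ℂ
      ![fun l => eval x (pderiv l (F i)), fun l => eval x (pderiv l (F j))] := by
  convert hnc.linearIndependent_comp ![i, j]
    (by simp [Function.Injective, Fin.forall_fin_two, hij, hij.symm]) hx (by simp [Fin.forall_fin_two, hi, hj]) with t
  fin_cases t <;> rfl

theorem NormalCrossings.linearIndependent_triple (hnc : NormalCrossings F) {i j k : Fin m}
    (hij : i ≠ j) (hki : k ≠ i) (hkj : k ≠ j) (x : Fin (n + 1) → ℂ) (hx : x ≠ 0)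
    (hi : eval x (F i) = 0) (hj : eval x (F j) = 0) (hk : eval x (F k) = 0) :
    LinearIndependent ℂ ![fun l => eval x (pderiv l (F i)), fun l => eval x (pderiv l (F j)),
      fun l => eval x (pderiv l (F k))] := by
  convert hnc.linearIndependent_comp ![i, j, k]
    (by simp [Function.Injective, Fin.forall_fin_succ, hij, hij.symm, hki, hkj, hki.symm, hkj.symm])
    hx (by simp [Fin.forall_fin_succ, hi, hj, hk]) with t
  fin_cases t <;> rfl

theorem NormalCrossings.not_dvd (hnc : NormalCrossings F) (hn : n ≠ 0) {i j : Fin m}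
    (hij : i ≠ j) : ¬ F i ∣ F j := by
  have : Nontrivial (Fin (n + 1)) := Fin.nontrivial_iff_two_le.mpr (by omega)
  exact not_dvd_of_linearIndependent (hnc.irreducible i) (hnc.linearIndependent_pair hij)

theorem NormalCrossings.exists_eq_sum_hatProd_mul (hnc : NormalCrossings F)
    (hF : ∀ i, (F i).IsHomogeneous (deg i)) (hm : 0 < m) {a : PolyRing n}
    (ha : a.IsHomogeneous (∑ i, deg i - 1)) (hv : ∀ x ∈ coneStratum F 2, eval x a = 0) :
    ∃ c : Fin m → PolyRing n, a = ∑ i, hatProd F i * c i := by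
  have hne : (Finset.univ : Finset (Fin m)).Nonempty := ⟨⟨0, hm⟩, Finset.mem_univ _⟩
  have hdeg := deg_ne_zero hF hnc.irreducible
  obtain rfl | rfl | hn : n = 0 ∨ n = 1 ∨ 2 ≤ n := by omega
  · set i₀ : Fin m := ⟨0, hm⟩
    have hσ : ∀ l : Fin (0 + 1), l = 0 := Fin.eq_zero
    have hh := hatProd_isHomogeneous hF i₀
    have hhat := hh.eq_C_mul_X_pow hσ
    have hhat0 : hatProd F i₀ ≠ 0 :=
      Finset.prod_ne_zero_iff.mpr fun j _ => (hnc.irreducible j).ne_zero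
    have he : eval 1 (hatProd F i₀) ≠ 0 := by
      intro h0
      rw [h0, map_zero, zero_mul] at hhat
      exact hhat0 hhat
    have hle := Finset.single_le_sum (f := deg) (fun _ _ => Nat.zero_le _) (Finset.mem_univ i₀)
    have h1 := hdeg i₀
    -- In one variable `F̂_{i₀}` is a nonzero monomial of degree at most `d - 1`, so a single term
    -- suffices.
    refine ⟨Pi.single i₀ (C (eval 1 a / eval 1 (hatProd F i₀)) * X 0 ^ (deg i₀ - 1)), ?_⟩
    rw [Finset.sum_eq_single i₀ (fun j _ hj => by simp [hj]) (by simp), Pi.single_eq_same]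
    conv_lhs => rw [ha.eq_C_mul_X_pow hσ]
    have h2 : ∑ i, deg i - 1 = (∑ i, deg i - deg i₀) + (deg i₀ - 1) := by omega
    have h3 : eval 1 a = eval 1 (hatProd F i₀) * (eval 1 a / eval 1 (hatProd F i₀)) := by
      field_simp
    rw [h2, h3, pow_add, C_mul, ← h3]
    conv_rhs => rw [hhat]
    simp only [eval_C, map_mul, map_pow, eval_X, Pi.one_apply, one_pow, mul_one]
    ring
  · exact exists_eq_sum_prod_erase_mul_of_card_eq_two (by simp) F deg hnc.irreducible hF
      (fun i j hij => hnc.not_dvd one_ne_zero hij) _ hne a ha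
  · have hcard : 2 < Fintype.card (Fin (n + 1)) := by simp; omega
    have hF0 : ∀ i, eval 0 (F i) = 0 := fun i => eval_zero_eq_zero (hF i) (hdeg i)
    refine exists_eq_sum_prod_erase_mul F _ hne (fun i _ j _ k _ hij hki hkj b hb => ?_) a
      (fun i _ j _ hij => ?_)
    · exact mem_span_pair_of_mul_mem hcard (hnc.irreducible i) (hnc.not_dvd (by omega) hij) (hF0 i)
        (hnc.linearIndependent_pair hij) (hnc.linearIndependent_triple hij hki hkj) hb
    · exact mem_span_pair_of_eval_eq_zero hcard (hnc.irreducible i) (hnc.not_dvd (by omega) hij)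
        (hF0 i) (hnc.linearIndependent_pair hij)
        fun x hi hj => hv x (mem_coneStratum_two hij hi hj)

theorem NormalCrossings.exists_isHomogeneous_eq_sum_hatProd_mul (hnc : NormalCrossings F)
    (hF : ∀ i, (F i).IsHomogeneous (deg i)) (hm : 0 < m) {a : PolyRing n}
    (ha : a.IsHomogeneous (∑ i, deg i - 1)) (hv : ∀ x ∈ coneStratum F 2, eval x a = 0) :
    ∃ c : Fin m → PolyRing n, (∀ i, (c i).IsHomogeneous (deg i - 1)) ∧
      a = ∑ i, hatProd F i * c i := by
  obtain ⟨c, hc⟩ := hnc.exists_eq_sum_hatProd_mul hF hm ha hv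
  refine ⟨fun i => homogeneousComponent (deg i - 1) (c i),
    fun i => homogeneousComponent_isHomogeneous _ _, ?_⟩
  -- Only the component of degree `d - 1` of the relation is kept.
  conv_lhs => rw [← homogeneousComponent_eq_self ha, hc, map_sum]
  refine Finset.sum_congr rfl fun i _ => ?_
  have hle := Finset.single_le_sum (f := deg) (fun _ _ => Nat.zero_le _) (Finset.mem_univ i)
  have h1 := deg_ne_zero hF hnc.irreducible i
  rw [← (hatProd_isHomogeneous hF i).homogeneousComponent_mul]
  congr 2
  omega

theorem NormalCrossings.exists_eq_sum_hatProd_smul (hnc : NormalCrossings F)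
    (hF : ∀ i, (F i).IsHomogeneous (deg i)) {α : OneForm n}
    (hα : IsFormOfDegree (∑ i, deg i) α) (hv : VanishesOnAffine α (coneStratum F 2)) :
    ∃ β : Fin m → OneForm n, (∀ i, IsFormOfDegree (deg i) (β i)) ∧
      α = ∑ i, hatProd F i • β i := by
  rcases Nat.eq_zero_or_pos m with rfl | hm
  -- With no hypersurfaces `d = 0`, and the convention for degree zero forces `α = 0`.
  · refine ⟨0, fun i => i.elim0, form_ext fun j => ?_⟩
    rw [(hα j).2 (by simp), Fintype.sum_empty]
    simp [formCoeff]
  · have h : ∀ j, ∃ c : Fin m → PolyRing n, (∀ i, (c i).IsHomogeneous (deg i - 1)) ∧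
        formCoeff α j = ∑ i, hatProd F i * c i := fun j =>
      hnc.exists_isHomogeneous_eq_sum_hatProd_mul hF hm (hα j).1
        fun x hx => congrFun (hv x hx) j
    choose c hc hac using h
    refine ⟨fun i => formOfCoeff fun j => c j i, fun i => ?_, form_ext fun j => ?_⟩
    · rw [isFormOfDegree_iff (deg_ne_zero hF hnc.irreducible i)]
      intro j
      rw [formCoeff_formOfCoeff]
      exact hc j i
    · simp [hac]

/-- A relation `∑ F̂_i e_i = 0` forces `e_i` to be a scalar multiple of `F_i`, and the scalars sum
to zero. -/
theorem NormalCrossings.exists_eq_C_mul_of_sum_eq_zero (hnc : NormalCrossings F)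
    (hF : ∀ i, (F i).IsHomogeneous (deg i)) {e : Fin m → PolyRing n}
    (he : ∀ i, (e i).IsHomogeneous (deg i)) (hsum : ∑ i, hatProd F i * e i = 0) :
    ∃ c : Fin m → ℂ, (∀ i, e i = C (c i) * F i) ∧ ∑ i, c i = 0 := by
  have hne : ∀ i, F i ≠ 0 := fun i => (hnc.irreducible i).ne_zero
  have h : ∀ i, ∃ c : ℂ, e i = C c * F i := by
    intro i
    -- For `n = 0` the `F i` may be proportional to one another, so monomials are compared directly.
    rcases Nat.eq_zero_or_pos n with rfl | hn
    · have hσ : ∀ l : Fin (0 + 1), l = 0 := Fin.eq_zero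
      have h1 := (hF i).eq_C_mul_X_pow hσ
      have h2 := (he i).eq_C_mul_X_pow hσ
      have h3 : eval 1 (F i) ≠ 0 := by
        intro h0
        rw [h0, map_zero, zero_mul] at h1
        exact hne i h1
      refine ⟨eval 1 (e i) / eval 1 (F i), ?_⟩
      rw [h1, ← mul_assoc, ← C_mul, eval_mul, eval_C, eval_pow, eval_X, Pi.one_apply, one_pow,
        mul_one, div_mul_cancel₀ _ h3]
      exact h2
    · have hp := (hnc.irreducible i).prime
      have hdvd : F i ∣ hatProd F i * e i := by
        rw [← Finset.add_sum_erase _ _ (Finset.mem_univ i)] at hsum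
        rw [eq_neg_of_add_eq_zero_left hsum]
        refine (Finset.dvd_sum fun j hj => Dvd.dvd.mul_right (Finset.dvd_prod_of_mem _ ?_) _).neg_right
        exact Finset.mem_erase.mpr ⟨(Finset.ne_of_mem_erase hj).symm, Finset.mem_univ i⟩
      have hnd : ¬ F i ∣ hatProd F i := by
        intro hd
        obtain ⟨j, hj, hij⟩ := (hp.dvd_finsetProd_iff _).mp hd
        exact hnc.not_dvd hn.ne' (Finset.ne_of_mem_erase hj).symm hij
      obtain ⟨q, hq⟩ := (hp.dvd_or_dvd hdvd).resolve_left hnd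
      have hqh : q.IsHomogeneous 0 := (hF i).of_mul_left (hne i) (by
        rw [← hq, add_zero]
        exact he i)
      refine ⟨coeff 0 q, ?_⟩
      rw [hq, mul_comm]
      congr 1
      exact totalDegree_eq_zero_iff_eq_C.mp ((totalDegree_zero_iff_isHomogeneous _).mpr hqh)
  choose c hc using h
  refine ⟨c, hc, ?_⟩
  have h1 : C (∑ i, c i) * ∏ j, F j = 0 := by
    rw [← hsum, map_sum, Finset.sum_mul]
    refine Finset.sum_congr rfl fun i _ => ?_
    rw [hc i, ← mul_hatProd F i]
    ring
  have h2 := (mul_eq_zero.mp h1).resolve_right (Finset.prod_ne_zero_iff.mpr fun j _ => hne j)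
  rwa [C_eq_zero] at h2

theorem mem_coneStratum_of_mk_mem (hF : ∀ i, (F i).IsHomogeneous (deg i)) {r : ℕ}
    {x : Fin (n + 1) → ℂ} (hx : x ≠ 0) (h : Projectivization.mk ℂ x hx ∈ projStratum F r) :
    x ∈ coneStratum F r := by
  obtain ⟨y, hy, ⟨A, hA, hAy⟩, hxy⟩ := h
  obtain ⟨t, rfl⟩ := (Projectivization.mk_eq_mk_iff' ℂ x y hx hy).mp hxy.symm
  exact ⟨A, hA, fun i hi => by rw [(hF i).eval_smul, hAy i hi, mul_zero]⟩

/-- Only the origin is at stake: if it lies in the cone, there are two distinct indices, so `d ≥ 2`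
and the coefficients, of positive degree, vanish there. -/
theorem vanishesOnProj_iff (hF : ∀ i, (F i).IsHomogeneous (deg i))
    (hirr : ∀ i, Irreducible (F i)) {α : OneForm n} (hα : IsFormOfDegree (∑ i, deg i) α) :
    VanishesOnProj α (projStratum F 2) ↔ VanishesOnAffine α (coneStratum F 2) := by
  constructor
  · intro h x hx
    by_cases hx0 : x = 0
    · subst hx0
      obtain ⟨A, hA, -⟩ := hx
      obtain ⟨i, j, hij, -⟩ := Finset.card_eq_two.mp hA
      have h1 := deg_ne_zero hF hirr i
      have h2 := deg_ne_zero hF hirr j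
      have h3 := Finset.add_le_sum (f := deg) (fun _ _ => Nat.zero_le _) (Finset.mem_univ i)
        (Finset.mem_univ j) hij
      ext l
      exact eval_zero_eq_zero (hα l).1 (by omega)
    · exact h x hx0 ⟨x, hx0, hx, rfl⟩
  · exact fun h x hx hmem => h x (mem_coneStratum_of_mk_mem hF hx hmem)

end Forms

end LogForms

/-! ### The two equivalences. -/

open LogForms in
theorem proposition8 (n m : ℕ) (deg : Fin m → ℕ) (F : Fin m → PolyRing n)
    (hF : ∀ i, (F i).IsHomogeneous (deg i)) (hnc : NormalCrossings F)
    (α : OneForm n) (hα : IsFormOfDegree (∑ i, deg i) α) :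
    (VanishesOnAffine α (coneStratum F 2) ↔
      ∃ β : Fin m → OneForm n, (∀ i, IsFormOfDegree (deg i) (β i)) ∧
        α = ∑ i, hatProd F i • β i) ∧
    ((IsProjectiveForm (∑ i, deg i) α ∧ VanishesOnProj α (projStratum F 2)) ↔
      ∃ (lam : Fin m → ℂ) (γ : Fin m → OneForm n),
        ∑ i, (deg i : ℂ) * lam i = 0 ∧
        (∀ i, IsProjectiveForm (deg i) (γ i)) ∧
        α = ∑ i, lam i • (hatProd F i • extD (F i)) + ∑ i, hatProd F i • γ i) := by
  refine ⟨⟨hnc.exists_eq_sum_hatProd_smul hF hα, ?_⟩, ?_⟩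
  · rintro ⟨β, -, rfl⟩
    exact vanishesOnAffine_sum_hatProd_smul β
  rw [vanishesOnProj_iff hF hnc.irreducible hα]
  constructor
  · rintro ⟨⟨-, hrad⟩, hv⟩
    obtain ⟨β, hβ, rfl⟩ := hnc.exists_eq_sum_hatProd_smul hF hα hv
    have hdeg := deg_ne_zero hF hnc.irreducible
    rw [radialContraction_sum] at hrad
    simp only [radialContraction_smul] at hrad
    obtain ⟨c, hc, hc0⟩ := hnc.exists_eq_C_mul_of_sum_eq_zero hF
      (fun i => (hβ i).radialContraction) hrad
    -- The contraction of `β i` is `c i * F i` and that of `dF_i` is `deg i * F i`, whence the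
    -- quotient.
    refine ⟨fun i => c i / deg i, fun i => β i - (c i / deg i : ℂ) • extD (F i), ?_,
      fun i => ⟨?_, ?_⟩, ?_⟩
    · rw [← hc0]
      refine Finset.sum_congr rfl fun i _ => mul_div_cancel₀ _ (Nat.cast_ne_zero.mpr (hdeg i))
    · rw [isFormOfDegree_iff (hdeg i)]
      intro j
      rw [formCoeff_sub, formCoeff_complex_smul, formCoeff_extD]
      exact (hβ i j).1.sub ((hF i).pderiv.C_mul _)
    · rw [radialContraction_sub, radialContraction_complex_smul, radialContraction_extD (hF i),
        hc i, ← mul_assoc, ← C_mul, div_mul_cancel₀ _ (Nat.cast_ne_zero.mpr (hdeg i)), sub_self]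
    · rw [← Finset.sum_add_distrib]
      refine Finset.sum_congr rfl fun i _ => ?_
      rw [smul_sub, smul_comm (hatProd F i), add_sub_cancel]
  · rintro ⟨lam, γ, hlam, hγ, rfl⟩
    refine ⟨⟨hα, ?_⟩, ?_⟩
    · rw [radialContraction_add, radialContraction_sum, radialContraction_sum]
      have h1 : ∑ i, radialContraction (hatProd F i • γ i) = 0 :=
        Finset.sum_eq_zero fun i _ => by rw [radialContraction_smul, (hγ i).2, mul_zero]
      have h2 : ∑ i, radialContraction (lam i • hatProd F i • extD (F i)) =
          C (∑ i, (deg i : ℂ) * lam i) * ∏ j, F j := by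
        rw [map_sum, Finset.sum_mul]
        refine Finset.sum_congr rfl fun i _ => ?_
        rw [radialContraction_complex_smul, radialContraction_smul, radialContraction_extD (hF i),
          ← mul_hatProd F i, C_mul]
        ring
      rw [h1, h2, hlam, map_zero, zero_mul, add_zero]
    · have h : ∑ i, lam i • (hatProd F i • extD (F i)) + ∑ i, hatProd F i • γ i =
          ∑ i, hatProd F i • (lam i • extD (F i) + γ i) := by
        rw [← Finset.sum_add_distrib]
        exact Finset.sum_congr rfl fun i _ => by rw [smul_add, smul_comm (hatProd F i)]
      rw [h]
      exact vanishesOnAffine_sum_hatProd_smul _
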